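/- A *p-algebra* is a bounded distributive lattice with an additional unary operation ${}^*$ satisfying $x\wedge y=0 \iff x\le y^*$; let $\mathsf{Pa}$ be the class of all p-algebras. For $m\in\mathbb N$ let $\bar{\mathbf B}_m$ be the p-algebra obtained from the Boolean algebra with $m$ atoms by adding a new element above its top element, and let $\mathsf{Pa}_m=\mathbf{HSP}(\bar{\mathbf B}_m)$ be the variety it generates. A subquasivariety of $\mathsf{Pa}$ is a class of p-algebras axiomatized, within $\mathsf{Pa}$, by a set of quasi-identities; these classes are ordered by inclusion. A subquasivariety $\mathsf K$ is a cover of $\mathsf{Pa}_m$ if $\mathsf{Pa}_m\subsetneq\mathsf K$ and no subquasivariety $\mathsf L$ satisfies $\mathsf{Pa}_m\subsetneq\mathsf L\subsetneq\mathsf K$. **Theorem.** For every $m\ge 2$, the variety $\mathsf{Pa}_m$ has exactly one cover in the lattice of subquasivarieties of $\mathsf{Pa}$. -/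

import Mathlib

universe u v w

namespace PAlgebras

/-! ### p-algebras and their homomorphisms -/

/-- A (distributive) p-algebra: a bounded distributive lattice with a unary operation `pc`
(written `*` in the literature) such that `x ⊓ y = ⊥` iff `x ≤ y*`. -/
class PAlgebra (A : Type u) extends DistribLattice A, BoundedOrder A where
  pc : A → A
  inf_eq_bot_iff : ∀ x y : A, x ⊓ y = ⊥ ↔ x ≤ pc y

/-- A map between p-algebras is a homomorphism if it preserves all the operations. -/
structure IsHom {A : Type u} {B : Type v} [PAlgebra A] [PAlgebra B] (f : A → B) : Prop where
  map_bot : f ⊥ = ⊥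
  map_top : f ⊤ = ⊤
  map_inf : ∀ x y, f (x ⊓ y) = f x ⊓ f y
  map_sup : ∀ x y, f (x ⊔ y) = f x ⊔ f y
  map_pc : ∀ x, f (PAlgebra.pc x) = PAlgebra.pc (f x)

/-- The class `Pa` of all p-algebras (with carrier in `Type u`). -/
structure PAlg : Type (u + 1) where
  carrier : Type u
  [str : PAlgebra carrier]

attribute [instance] PAlg.str

/-- Direct products of p-algebras, with the coordinatewise operations. -/
instance instPAlgebraPi {I : Type u} (F : I → Type v) [∀ i, PAlgebra (F i)] :
    PAlgebra (∀ i, F i) where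
  pc x := fun i => PAlgebra.pc (x i)
  inf_eq_bot_iff x y := by
    rw [funext_iff, Pi.le_def]
    exact forall_congr' fun i => PAlgebra.inf_eq_bot_iff (x i) (y i)

/-! ### The class operators `H`, `S`, `P` (classes are closed under isomorphic copies) -/

/-- Homomorphic images of members of `K`. -/
def classH (K : Set PAlg.{u}) : Set PAlg.{u} :=
  {A | ∃ B ∈ K, ∃ f : B.carrier → A.carrier, IsHom f ∧ Function.Surjective f}

/-- Algebras isomorphic to a subalgebra of a member of `K`. -/
def classS (K : Set PAlg.{u}) : Set PAlg.{u} :=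
  {A | ∃ B ∈ K, ∃ f : A.carrier → B.carrier, IsHom f ∧ Function.Injective f}

/-- Algebras isomorphic to a direct product of a (possibly empty) family of members of `K`. -/
def classP (K : Set PAlg.{u}) : Set PAlg.{u} :=
  {A | ∃ (I : Type u) (F : I → PAlg.{u}), (∀ i, F i ∈ K) ∧
    ∃ f : A.carrier → (∀ i, (F i).carrier), IsHom f ∧ Function.Bijective f}

/-! ### Terms, quasi-identities, quasivarieties -/

/-- Terms in the language of p-algebras. -/
inductive Term (X : Type u) : Type u where
  | var : X → Term X
  | bot : Term X
  | top : Term X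
  | inf : Term X → Term X → Term X
  | sup : Term X → Term X → Term X
  | pc : Term X → Term X

/-- The value of a term under an assignment of the variables. -/
def Term.eval {X : Type u} {A : Type v} [PAlgebra A] (a : X → A) : Term X → A
  | .var x => a x
  | .bot => ⊥
  | .top => ⊤
  | .inf s t => s.eval a ⊓ t.eval a
  | .sup s t => s.eval a ⊔ t.eval a
  | .pc t => PAlgebra.pc (t.eval a)

/-- A quasi-identity `s₁ = t₁ ∧ … ∧ sₙ = tₙ → s = t` (with `n = 0` allowed). -/
structure QuasiIdentity : Type where
  premises : List (Term ℕ × Term ℕ)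
  lhs : Term ℕ
  rhs : Term ℕ

/-- Validity of a quasi-identity in a p-algebra. -/
def QuasiIdentity.Holds (q : QuasiIdentity) (A : Type u) [PAlgebra A] : Prop :=
  ∀ a : ℕ → A, (∀ e ∈ q.premises, e.1.eval a = e.2.eval a) → q.lhs.eval a = q.rhs.eval a

/-- A class of p-algebras is a quasivariety if it is axiomatized, within the class of all
p-algebras, by a set of quasi-identities. -/
def IsQuasivariety (K : Set PAlg.{u}) : Prop :=
  ∃ E : Set QuasiIdentity, K = {A | ∀ q ∈ E, q.Holds A.carrier}

/-- The subquasivarieties of `Pa`. -/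
structure Subquasivariety : Type (u + 1) where
  carrier : Set PAlg.{u}
  isQuasivariety : IsQuasivariety carrier

/-- Subquasivarieties are ordered by inclusion. -/
instance instPartialOrderSubquasivariety : PartialOrder Subquasivariety.{u} :=
  PartialOrder.lift Subquasivariety.carrier fun K L h => by
    cases K; cases L; cases h; rfl

/-! ### The algebras `B̄ₘ` -/

/-- The Boolean algebra with `m` atoms (the subsets of an `m`-element set), with a new element
placed on top of its top element. -/
abbrev BBar (m : ℕ) : Type u := WithTop (Set (ULift.{u} (Fin m)))

open Classical in
/-- The pseudocomplement of `BBar m`. -/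
noncomputable def BBar.pc {m : ℕ} : BBar.{u} m → BBar.{u} m
  | ⊤ => ⊥
  | (s : Set (ULift.{u} (Fin m))) => if s = ∅ then ⊤ else (sᶜ : Set (ULift.{u} (Fin m)))

noncomputable instance instPAlgebraBBar (m : ℕ) : PAlgebra (BBar.{u} m) where
  pc := BBar.pc
  inf_eq_bot_iff x y := by
    induction y using WithTop.recTopCoe with
    | top => simp [BBar.pc]
    | coe t =>
      by_cases ht : t = ∅
      · subst ht
        have h0 : ((∅ : Set (ULift.{u} (Fin m))) : BBar.{u} m) = ⊥ := rfl
        simp [BBar.pc, h0]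
      · induction x using WithTop.recTopCoe with
        | top => simp [BBar.pc, ht, ← WithTop.coe_bot]
        | coe s =>
          simp only [BBar.pc, ht, if_false, ← WithTop.coe_inf, ← WithTop.coe_bot,
            WithTop.coe_inj, WithTop.coe_le_coe]
          rw [← disjoint_iff]
          exact le_compl_iff_disjoint_right.symm

/-! ### Birkhoff's theorem for the variety generated by one algebra -/

theorem IsHom.map_eval {A : Type u} {B : Type v} [PAlgebra A] [PAlgebra B] {f : A → B}
    (hf : IsHom f) {X : Type w} (a : X → A) (t : Term X) :
    f (t.eval a) = t.eval (fun x => f (a x)) := by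
  induction t with
  | var x => rfl
  | bot => exact hf.map_bot
  | top => exact hf.map_top
  | inf s t hs ht => simp only [Term.eval, hf.map_inf, hs, ht]
  | sup s t hs ht => simp only [Term.eval, hf.map_sup, hs, ht]
  | pc t ht => simp only [Term.eval, hf.map_pc, ht]

/-- The evaluation at a coordinate of a product is a homomorphism. -/
theorem isHom_apply {I : Type u} (F : I → Type v) [∀ i, PAlgebra (F i)] (i : I) :
    IsHom (fun x : (∀ i, F i) => x i) where
  map_bot := rfl
  map_top := rfl
  map_inf _ _ := rfl
  map_sup _ _ := rfl
  map_pc _ := rfl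

/-- Substitution of variables. -/
def Term.rename {X : Type u} {Y : Type v} (r : X → Y) : Term X → Term Y
  | .var x => .var (r x)
  | .bot => .bot
  | .top => .top
  | .inf s t => .inf (s.rename r) (t.rename r)
  | .sup s t => .sup (s.rename r) (t.rename r)
  | .pc t => .pc (t.rename r)

theorem Term.eval_rename {X : Type u} {Y : Type v} {A : Type w} [PAlgebra A] (r : X → Y)
    (a : Y → A) (t : Term X) : (t.rename r).eval a = t.eval (fun x => a (r x)) := by
  induction t <;> simp_all [Term.eval, Term.rename]

/-- The set of variables of a term. -/
def Term.vars {X : Type u} : Term X → Set X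
  | .var x => {x}
  | .bot => ∅
  | .top => ∅
  | .inf s t => s.vars ∪ t.vars
  | .sup s t => s.vars ∪ t.vars
  | .pc t => t.vars

theorem Term.finite_vars {X : Type u} (t : Term X) : t.vars.Finite := by
  induction t <;> simp_all [Term.vars]

theorem Term.eval_congr {X : Type u} {A : Type v} [PAlgebra A] {a b : X → A} (t : Term X)
    (h : ∀ x ∈ t.vars, a x = b x) : t.eval a = t.eval b := by
  induction t with
  | var x => exact h x rfl
  | bot => rfl
  | top => rfl
  | inf s t hs ht =>
    simp only [Term.eval, hs fun x hx => h x (Or.inl hx), ht fun x hx => h x (Or.inr hx)]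
  | sup s t hs ht =>
    simp only [Term.eval, hs fun x hx => h x (Or.inl hx), ht fun x hx => h x (Or.inr hx)]
  | pc t ht => simp only [Term.eval, ht h]

/-- If all identities (in the variables indexed by `ℕ`) of `B` hold in `A`, then so do its
identities in any set of variables. -/
theorem eval_eq_of_identities {A : Type u} {B : Type v} [PAlgebra A] [PAlgebra B]
    (h : ∀ s t : Term ℕ, (∀ b : ℕ → B, s.eval b = t.eval b) →
      ∀ a : ℕ → A, s.eval a = t.eval a)
    {X : Type w} (s t : Term X) (hst : ∀ b : X → B, s.eval b = t.eval b) (a : X → A) :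
    s.eval a = t.eval a := by
  classical
  have hfin : (s.vars ∪ t.vars).Finite := s.finite_vars.union t.finite_vars
  obtain ⟨r, hr⟩ := Set.countable_iff_exists_injOn.1 hfin.countable
  have key := h (s.rename r) (t.rename r) (fun b => by
    rw [Term.eval_rename, Term.eval_rename]; exact hst _)
    (fun n => if hn : ∃ x ∈ s.vars ∪ t.vars, r x = n then a hn.choose else ⊥)
  rw [Term.eval_rename, Term.eval_rename] at key
  have aux : ∀ x ∈ s.vars ∪ t.vars,
      (if hn : ∃ y ∈ s.vars ∪ t.vars, r y = r x then a hn.choose else ⊥) = a x := by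
    intro x hx
    have hn : ∃ y ∈ s.vars ∪ t.vars, r y = r x := ⟨x, hx, rfl⟩
    rw [dif_pos hn]
    exact congrArg a (hr hn.choose_spec.1 hx hn.choose_spec.2)
  rwa [Term.eval_congr s fun x hx => aux x (Or.inl hx),
    Term.eval_congr t fun x hx => aux x (Or.inr hx)] at key

/-- The p-algebra structure on the range of an evaluation map. -/
@[reducible] def rangeEval {X : Type u} {A : Type v} [PAlgebra A] (a : X → A) :
    PAlgebra (Set.range (fun t : Term X => t.eval a)) :=
  letI : Max (Set.range (fun t : Term X => t.eval a)) :=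
    ⟨fun x y => ⟨x.1 ⊔ y.1, by
      obtain ⟨_, s, rfl⟩ := x; obtain ⟨_, t, rfl⟩ := y; exact ⟨.sup s t, rfl⟩⟩⟩
  letI : Min (Set.range (fun t : Term X => t.eval a)) :=
    ⟨fun x y => ⟨x.1 ⊓ y.1, by
      obtain ⟨_, s, rfl⟩ := x; obtain ⟨_, t, rfl⟩ := y; exact ⟨.inf s t, rfl⟩⟩⟩
  { Subtype.val_injective.distribLattice (Subtype.val) Iff.rfl Iff.rfl
      (fun _ _ => rfl) (fun _ _ => rfl) with
    top := ⟨⊤, .top, rfl⟩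
    bot := ⟨⊥, .bot, rfl⟩
    le_top := fun x => le_top (a := x.1)
    bot_le := fun x => bot_le (a := x.1)
    pc := fun x => ⟨PAlgebra.pc x.1, by obtain ⟨_, s, rfl⟩ := x; exact ⟨.pc s, rfl⟩⟩
    inf_eq_bot_iff := fun x y =>
      Subtype.ext_iff.trans (PAlgebra.inf_eq_bot_iff x.1 y.1) }

theorem mem_HSP_iff (B A : PAlg.{u}) : A ∈ classH (classS (classP {B})) ↔
    ∀ s t : Term ℕ, (∀ b : ℕ → B.carrier, s.eval b = t.eval b) →
      ∀ a : ℕ → A.carrier, s.eval a = t.eval a := by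
  constructor
  · rintro ⟨C, ⟨D, ⟨I, F, hF, e, he, hebij⟩, g, hg, hginj⟩, f, hf, hfsurj⟩ s t hst a
    choose c hc using fun n => hfsurj (a n)
    obtain rfl : (fun n => f (c n)) = a := funext hc
    rw [← hf.map_eval, ← hf.map_eval]
    congr 1
    apply hginj
    rw [hg.map_eval, hg.map_eval]
    apply hebij.1
    rw [he.map_eval, he.map_eval]
    funext i
    have h1 := fun r : Term ℕ =>
      (isHom_apply (fun i => (F i).carrier) i).map_eval (fun x => e (g (c x))) r
    rw [h1, h1]
    have hi : F i = B := hF i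
    rw [← hi] at hst
    exact hst _
  · intro h
    let ev : A.carrier → ((A.carrier → B.carrier) → B.carrier) := fun x b => b x
    let _ := rangeEval ev
    have hev : ∀ (r : Term A.carrier) (b : A.carrier → B.carrier), (r.eval ev) b = r.eval b :=
      fun r b => (isHom_apply (fun _ => B.carrier) b).map_eval ev r
    have hwd : ∀ r r' : Term A.carrier, r.eval ev = r'.eval ev → r.eval id = r'.eval id :=
      fun r r' hr => eval_eq_of_identities h r r' (fun b => by
        rw [← hev, ← hev, hr]) id
    let f : Set.range (fun t : Term A.carrier => t.eval ev) → A.carrier :=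
      fun x => x.2.choose.eval id
    have hf : ∀ (x : Set.range (fun t : Term A.carrier => t.eval ev)) (r : Term A.carrier),
        x.1 = r.eval ev → f x = r.eval id :=
      fun x r hr => hwd _ _ (x.2.choose_spec.trans hr)
    refine ⟨⟨Set.range (fun t : Term A.carrier => t.eval ev)⟩,
      ⟨⟨(A.carrier → B.carrier) → B.carrier⟩, ⟨A.carrier → B.carrier, fun _ => B, fun _ => rfl,
        id, ⟨rfl, rfl, fun _ _ => rfl, fun _ _ => rfl, fun _ => rfl⟩, Function.bijective_id⟩,
        Subtype.val, ⟨rfl, rfl, fun _ _ => rfl, fun _ _ => rfl, fun _ => rfl⟩,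
        Subtype.val_injective⟩, f, ⟨?_, ?_, ?_, ?_, ?_⟩, ?_⟩
    · exact hf _ .bot rfl
    · exact hf _ .top rfl
    · rintro ⟨_, s, rfl⟩ ⟨_, t, rfl⟩
      rw [hf ⟨_, s, rfl⟩ s rfl, hf ⟨_, t, rfl⟩ t rfl]
      exact hf _ (.inf s t) rfl
    · rintro ⟨_, s, rfl⟩ ⟨_, t, rfl⟩
      rw [hf ⟨_, s, rfl⟩ s rfl, hf ⟨_, t, rfl⟩ t rfl]
      exact hf _ (.sup s t) rfl
    · rintro ⟨_, s, rfl⟩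
      rw [hf ⟨_, s, rfl⟩ s rfl]
      exact hf _ (.pc s) rfl
    · exact fun x => ⟨⟨_, .var x, rfl⟩, hf _ (.var x) rfl⟩

theorem isQuasivariety_HSP (B : PAlg.{u}) : IsQuasivariety (classH (classS (classP {B}))) := by
  refine ⟨{q | q.premises = [] ∧ q.Holds B.carrier}, ?_⟩
  ext A
  rw [mem_HSP_iff]
  constructor
  · rintro h ⟨p, s, t⟩ ⟨hp, hq⟩ a -
    obtain rfl : p = [] := hp
    exact h s t (fun b => hq b (by simp)) a
  · intro h s t hst a
    exact h ⟨[], s, t⟩ ⟨rfl, fun b _ => hst b⟩ a (by simp)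

/-! ### The varieties `Paₘ` -/

/-- The variety `Paₘ = HSP(B̄ₘ)`, as an element of the poset of subquasivarieties of `Pa`. -/
def Pa (m : ℕ) : Subquasivariety.{u} where
  carrier := classH (classS (classP {⟨BBar.{u} m⟩}))
  isQuasivariety := isQuasivariety_HSP _

end PAlgebras

/-!
The proof counts maximal filters. Homomorphisms from a p-algebra `A` to `B̄ₘ` come from prime
filters `p` lying in at most `m` maximal filters; as prime filters separate points, `A` belongs to
`Paₘ` as soon as every prime filter lies in at most `m` maximal filters, and Lee's identity gives
the converse when `1 ≤ m`.

So a quasivariety `L` properly containing `Paₘ` has a member `A` with a prime filter `p` contained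
in distinct maximal filters `M₀, …, Mₘ`. Disjoint `dᵢ ∈ Mᵢ` with dense join induce a homomorphism
into `A` from the algebra `C` of simplicial complexes on `m + 1` vertices, and the preimage of `p`
consists of the full simplex alone. Since a simplex with at most `m` vertices yields a homomorphism
from `C` to `B̄ₘ ∈ L`, the elements of `C` are separated by homomorphisms into members of `L`, hence
`C ∈ L`. As `C` is not in `Paₘ`, the quasivariety generated by `Paₘ` and `C` is the only cover.
-/

namespace PAlgebras

open Function Order
open PAlgebra (pc inf_eq_bot_iff)

theorem existsUnique_covBy_of_isLeast_Ioi {α : Type*} [PartialOrder α] {a b : α}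
    (h : IsLeast (Set.Ioi a) b) : ∃! c, a ⋖ c := by
  refine ⟨b, ⟨h.1, fun c hac => (h.2 hac).not_gt⟩, fun c hac => ?_⟩
  exact ((h.2 hac.lt).eq_of_not_lt fun hbc => hac.2 h.1 hbc).symm

section Cardinality

theorem nonempty_embedding_of_card_le {ι : Type u} {α : Type v} [Fintype ι]
    (h : (Fintype.card ι : ℕ∞) ≤ ENat.card α) : Nonempty (ι ↪ α) := by
  rw [← Cardinal.lift_mk_le', Cardinal.mk_fintype, Cardinal.lift_natCast, Cardinal.nat_le_lift_iff]
  exact Cardinal.natCast_le_toENat.1 h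

theorem exists_surjective_of_card_le {ι : Type u} {α : Type v} [Fintype ι] [Nonempty α]
    (h : ENat.card α ≤ Fintype.card ι) : ∃ f : ι → α, Surjective f := by
  have : Finite α := ENat.card_lt_top.1 (h.trans_lt (ENat.natCast_lt_top _))
  have := Fintype.ofFinite α
  rw [ENat.card_eq_coe_fintype_card, Nat.cast_le] at h
  obtain ⟨e⟩ := Embedding.nonempty_of_card_le h
  exact ⟨_, invFun_surjective e.injective⟩

end Cardinality

section Pseudocomplement

variable {A : Type v} [PAlgebra A] {a b : A}

theorem disjoint_iff_le_pc : Disjoint a b ↔ a ≤ pc b :=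
  disjoint_iff.trans (inf_eq_bot_iff a b)

theorem disjoint_pc_self (a : A) : Disjoint (pc a) a :=
  disjoint_iff_le_pc.2 le_rfl

theorem le_pc_comm : a ≤ pc b ↔ b ≤ pc a := by
  rw [← disjoint_iff_le_pc, ← disjoint_iff_le_pc, disjoint_comm]

theorem le_pc_pc (a : A) : a ≤ pc (pc a) :=
  le_pc_comm.1 le_rfl

theorem pc_anti (h : a ≤ b) : pc b ≤ pc a :=
  disjoint_iff_le_pc.1 ((disjoint_pc_self b).mono_right h)

theorem pc_bot : pc (⊥ : A) = ⊤ :=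
  top_le_iff.1 (disjoint_iff_le_pc.1 disjoint_bot_right)

theorem pc_top : pc (⊤ : A) = ⊥ :=
  disjoint_top.1 (disjoint_pc_self ⊤)

theorem pc_sup (a b : A) : pc (a ⊔ b) = pc a ⊓ pc b :=
  eq_of_forall_le_iff fun c => by
    simp only [← disjoint_iff_le_pc, le_inf_iff, disjoint_sup_right]

theorem pc_sup_pc_self (a : A) : pc (a ⊔ pc a) = ⊥ := by
  rw [pc_sup, inf_comm]
  exact (disjoint_pc_self (pc a)).eq_bot

theorem disjoint_pc_pc_right : Disjoint a (pc (pc b)) ↔ Disjoint a b := by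
  refine ⟨fun h => h.mono_right (le_pc_pc b), fun h => ?_⟩
  exact (disjoint_pc_self (pc b)).symm.mono_left (disjoint_iff_le_pc.1 h)

theorem pc_pc_inf (a b : A) : pc (pc (a ⊓ b)) = pc (pc a) ⊓ pc (pc b) := by
  refine le_antisymm (le_inf (pc_anti (pc_anti inf_le_left)) (pc_anti (pc_anti inf_le_right))) ?_
  have h : Disjoint (pc (a ⊓ b) ⊓ a) (pc (pc b)) :=
    disjoint_pc_pc_right.2 (disjoint_assoc.2 (disjoint_pc_self (a ⊓ b)))
  have h' : Disjoint (pc (a ⊓ b) ⊓ pc (pc b)) (pc (pc a)) :=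
    disjoint_pc_pc_right.2 (disjoint_right_comm.1 h)
  exact disjoint_iff_le_pc.1 (disjoint_assoc.1 (disjoint_right_comm.1 h')).symm

end Pseudocomplement

section PrimeFilter

theorem isPrime_iff_sup {A : Type v} [Lattice A] [OrderBot A] {p : PFilter A} :
    p.IsPrime ↔ ⊥ ∉ p ∧ ∀ a b, a ⊔ b ∈ p → a ∈ p ∨ b ∈ p := by
  rw [PFilter.isPrime_iff]
  constructor
  · intro h
    refine ⟨h.toIdeal.bot_mem, fun a b hab => ?_⟩
    by_contra! hcon
    exact h.toIdeal.sup_mem hcon.1 hcon.2 hab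
  · rintro ⟨hbot, hsup⟩
    refine ⟨fun a b hba ha hb => ha (PFilter.mem_of_le hba hb), ⟨⊥, hbot⟩, fun a ha b hb => ?_⟩
    exact ⟨a ⊔ b, fun hab => (hsup a b hab).elim ha hb, le_sup_left, le_sup_right⟩

theorem sup_mem_iff {A : Type v} [Lattice A] [OrderBot A] {p : PFilter A} (hp : p.IsPrime)
    {a b : A} : a ⊔ b ∈ p ↔ a ∈ p ∨ b ∈ p :=
  ⟨(isPrime_iff_sup.1 hp).2 a b,
    Or.rec (PFilter.mem_of_le le_sup_left) (PFilter.mem_of_le le_sup_right)⟩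

theorem finset_sup_mem_iff {A : Type v} [Lattice A] [OrderBot A] {p : PFilter A}
    (hp : p.IsPrime) {ι : Type w} {s : Finset ι} {f : ι → A} :
    s.sup f ∈ p ↔ ∃ i ∈ s, f i ∈ p := by
  refine ⟨fun h => ?_, fun ⟨i, hi, hfi⟩ => PFilter.mem_of_le (Finset.le_sup hi) hfi⟩
  by_contra! hcon
  exact Finset.sup_mem (pᶜ : Set A) (isPrime_iff_sup.1 hp).1
    (fun a ha b hb hab => ((isPrime_iff_sup.1 hp).2 a b hab).elim ha hb) s f hcon h

theorem exists_isPrime_of_notMem {A : Type v} [DistribLattice A] {F : PFilter A} {a : A}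
    (ha : a ∉ F) : ∃ p : PFilter A, p.IsPrime ∧ F ≤ p ∧ a ∉ p := by
  have hdisj : Disjoint (F : Set A) (Ideal.principal a) :=
    Set.disjoint_left.2 fun b hb hba => ha (PFilter.mem_of_le hba hb)
  obtain ⟨J, hJ, haJ, hFJ⟩ := DistribLattice.prime_ideal_of_disjoint_filter_ideal hdisj
  refine ⟨hJ.toPrimePair.F, hJ.toPrimePair.F_isPrime, ?_, ?_⟩
  · exact fun b hb => Set.disjoint_left.1 hFJ hb
  · exact fun h => h (Ideal.principal_le_iff.1 haJ)

theorem exists_isPrime_of_not_le {A : Type v} [DistribLattice A] {a b : A} (h : ¬ a ≤ b) :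
    ∃ p : PFilter A, p.IsPrime ∧ a ∈ p ∧ b ∉ p := by
  simpa only [PFilter.principal_le_iff] using
    exists_isPrime_of_notMem (F := PFilter.principal a) (PFilter.mem_principal.not.2 h)

end PrimeFilter

section Ultrafilter

variable {A : Type v} [PAlgebra A] {p M N : PFilter A} {a : A}

/-- Maximal proper filters of a p-algebra, encoded by the property that they contain exactly one of
`a` and `a*` for every `a`. -/
def IsUltra (M : PFilter A) : Prop :=
  ∀ a, pc a ∈ M ↔ a ∉ M

/-- The maximal filters containing a given filter. -/
def ultraAbove (p : PFilter A) : Set (PFilter A) :=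
  {M | IsUltra M ∧ p ≤ M}

theorem IsUltra.isPrime (hM : IsUltra M) : M.IsPrime := by
  refine isPrime_iff_sup.2 ⟨(hM ⊥).1 (pc_bot (A := A) ▸ PFilter.top_mem), fun a b hab => ?_⟩
  by_contra! hcon
  refine (hM (a ⊔ b)).1 ?_ hab
  rw [pc_sup]
  exact PFilter.inf_mem ((hM a).2 hcon.1) ((hM b).2 hcon.2)

theorem IsUltra.eq_of_le (hM : IsUltra M) (hN : IsUltra N) (h : M ≤ N) : M = N :=
  h.antisymm fun a haN => by_contra fun haM => (hN a).1 (h ((hM a).2 haM)) haN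

theorem isUltra_of_isPrime (hM : M.IsPrime) (h : ∀ d : A, pc d = ⊥ → d ∈ M) : IsUltra M := by
  obtain ⟨hbot, hsup⟩ := isPrime_iff_sup.1 hM
  refine fun a => ⟨fun hpc ha => hbot ?_, (hsup _ _ (h _ (pc_sup_pc_self a))).resolve_left⟩
  exact (disjoint_pc_self a).eq_bot ▸ PFilter.inf_mem hpc ha

theorem exists_mem_ultraAbove (ha : pc a ∉ p) : ∃ M ∈ ultraAbove p, a ∈ M := by
  let F : Set A := {z | ∃ x ∈ p, x ⊓ a ≤ pc (pc z)}
  have hF : IsPFilter F := by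
    refine .of_def ⟨⊤, ⊤, PFilter.top_mem, le_top.trans (le_pc_pc ⊤)⟩ ?_
      fun hyz ⟨x, hx, hxy⟩ => ⟨x, hx, hxy.trans (pc_anti (pc_anti hyz))⟩
    rintro y ⟨x, hx, hxy⟩ z ⟨w, hw, hwz⟩
    refine ⟨y ⊓ z, ⟨x ⊓ w, PFilter.inf_mem hx hw, ?_⟩, inf_le_left, inf_le_right⟩
    rw [pc_pc_inf]
    exact le_inf ((inf_le_inf_right a inf_le_left).trans hxy)
      ((inf_le_inf_right a inf_le_right).trans hwz)
  have mem_F : ∀ z, z ∈ hF.toPFilter ↔ ∃ x ∈ p, x ⊓ a ≤ pc (pc z) := fun _ => Iff.rfl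
  have hbot : ⊥ ∉ hF.toPFilter := by
    rw [mem_F]
    rintro ⟨x, hx, hxa⟩
    rw [pc_bot, pc_top, ← disjoint_iff_inf_le, disjoint_iff_le_pc] at hxa
    exact ha (PFilter.mem_of_le hxa hx)
  obtain ⟨M, hM, hFM, -⟩ := exists_isPrime_of_notMem hbot
  refine ⟨M, ⟨isUltra_of_isPrime hM fun d hd => hFM ?_, fun x hx => hFM ?_⟩, hFM ?_⟩
  · exact (mem_F d).2 ⟨⊤, PFilter.top_mem, by rw [hd, pc_bot]; exact le_top⟩
  · exact (mem_F x).2 ⟨x, hx, inf_le_left.trans (le_pc_pc x)⟩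
  · exact (mem_F a).2 ⟨⊤, PFilter.top_mem, inf_le_right.trans (le_pc_pc a)⟩

end Ultrafilter


section Quasivariety

theorem Subquasivariety.mem_of_separating (L : Subquasivariety.{u}) {A : PAlg.{u}}
    (h : ∀ x y : A.carrier, ¬ x ≤ y →
      ∃ B ∈ L.carrier, ∃ f : A.carrier → B.carrier, IsHom f ∧ ¬ f x ≤ f y) : A ∈ L.carrier := by
  obtain ⟨E, hE⟩ := L.isQuasivariety
  rw [hE] at h ⊢
  intro q hq a ha
  have map_eq : ∀ B : PAlg.{u}, (∀ q ∈ E, q.Holds B.carrier) →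
      ∀ f : A.carrier → B.carrier, IsHom f → f (q.lhs.eval a) = f (q.rhs.eval a) := by
    intro B hB f hf
    rw [hf.map_eval, hf.map_eval]
    exact hB q hq _ fun e he => by rw [← hf.map_eval, ← hf.map_eval, ha e he]
  refine le_antisymm ?_ ?_ <;> by_contra hne
  · obtain ⟨B, hB, f, hf, hfne⟩ := h _ _ hne
    exact hfne (map_eq B hB f hf).le
  · obtain ⟨B, hB, f, hf, hfne⟩ := h _ _ hne
    exact hfne (map_eq B hB f hf).ge

theorem BBar_mem_Pa (m : ℕ) : (⟨BBar.{u} m⟩ : PAlg.{u}) ∈ (Pa.{u} m).carrier :=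
  (mem_HSP_iff _ _).2 fun _ _ h => h

/-- The least quasivariety containing a class of p-algebras. -/
def Subquasivariety.generate (K : Set PAlg.{u}) : Subquasivariety.{u} where
  carrier := {A | ∀ q ∈ {q : QuasiIdentity | ∀ B ∈ K, q.Holds B.carrier}, q.Holds A.carrier}
  isQuasivariety := ⟨_, rfl⟩

theorem Subquasivariety.generate_le_iff {K : Set PAlg.{u}} {L : Subquasivariety.{u}} :
    Subquasivariety.generate K ≤ L ↔ K ⊆ L.carrier := by
  refine ⟨fun h A hA => h fun q hq => hq A hA, fun h A hA => ?_⟩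
  obtain ⟨E, hE⟩ := L.isQuasivariety
  rw [hE] at h ⊢
  exact fun q hq => hA q fun B hB => h hB q hq

end Quasivariety

section HomToBBar

variable {A : Type v} [PAlgebra A] {m : ℕ} {p : PFilter A}

theorem pc_BBar_coe {s : Set (ULift.{u} (Fin m))} (hs : s.Nonempty) :
    pc (s : BBar.{u} m) = ((sᶜ : Set (ULift.{u} (Fin m))) : BBar.{u} m) :=
  if_neg hs.ne_empty

open Classical in
/-- The map to `B̄ₘ` sending the prime filter `p` to the new top element, and any other element to
the set of those of the given maximal filters that contain it. -/
noncomputable def toBBar (p : PFilter A) (M : ULift.{u} (Fin m) → PFilter A) (a : A) : BBar.{u} m :=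
  if a ∈ p then ⊤ else ({i | a ∈ M i} : Set (ULift.{u} (Fin m)))

theorem toBBar_eq_top_iff {M : ULift.{u} (Fin m) → PFilter A} {a : A} :
    toBBar p M a = ⊤ ↔ a ∈ p := by
  simp [toBBar]

theorem isHom_toBBar (hp : p.IsPrime) {M : ULift.{u} (Fin m) → PFilter A}
    (hM : ∀ i, IsUltra (M i)) (hpM : ∀ i, p ≤ M i) (hcov : ∀ a, pc a ∉ p → ∃ i, a ∈ M i) :
    IsHom (toBBar p M) where
  map_bot := by
    simp [toBBar, (isPrime_iff_sup.1 hp).1, fun i => (isPrime_iff_sup.1 (hM i).isPrime).1]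
  map_top := by simp [toBBar]
  map_inf a b := by
    have mem_of_mem {c : A} (hc : c ∈ p) (i) : c ∈ M i := hpM i hc
    by_cases ha : a ∈ p <;> by_cases hb : b ∈ p <;>
      simp [toBBar, PFilter.inf_mem_iff, ha, hb, mem_of_mem, ← WithTop.coe_inf, Set.ofPred_and]
  map_sup a b := by
    have trace_sup : {i | a ⊔ b ∈ M i} = {i | a ∈ M i} ∪ {i | b ∈ M i} :=
      Set.ext fun i => sup_mem_iff (hM i).isPrime
    by_cases ha : a ∈ p <;> by_cases hb : b ∈ p <;>
      simp [toBBar, sup_mem_iff hp, ha, hb, trace_sup, ← WithTop.coe_sup]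
  map_pc a := by
    by_cases ha : ∃ i, a ∈ M i
    · have hpc : pc a ∉ p := fun h => ha.elim fun i hi => (hM i a).1 (hpM i h) hi
      by_cases hap : a ∈ p
      · simp [toBBar, hpc, hap, fun i => hM i a, fun i => hpM i hap, pc_top]
      · simp only [toBBar, hpc, hap, if_false, fun i => hM i a]
        exact (pc_BBar_coe ha).symm
    · have hpc : pc a ∈ p := by_contra fun h => ha (hcov a h)
      obtain ⟨i, -⟩ := hcov ⊤ (pc_top (A := A) ▸ (isPrime_iff_sup.1 hp).1)
      have hap : a ∉ p := fun h => ha ⟨i, hpM i h⟩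
      have hbot : toBBar p M a = ⊥ := by
        simpa [toBBar, hap, Set.eq_empty_iff_forall_notMem] using ha
      rw [hbot, pc_bot]
      exact toBBar_eq_top_iff.2 hpc

theorem exists_isHom_BBar {ι : Type w} (hι : ENat.card ι ≤ m) (hp : p.IsPrime)
    {M : ι → PFilter A} (hM : ∀ i, IsUltra (M i)) (hpM : ∀ i, p ≤ M i)
    (hcov : ∀ a, pc a ∉ p → ∃ i, a ∈ M i) :
    ∃ f : A → BBar.{u} m, IsHom f ∧ ∀ a, f a = ⊤ ↔ a ∈ p := by
  obtain ⟨i, -⟩ := hcov ⊤ (pc_top (A := A) ▸ (isPrime_iff_sup.1 hp).1)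
  have : Nonempty ι := ⟨i⟩
  obtain ⟨e, he⟩ := exists_surjective_of_card_le (ι := ULift.{u} (Fin m)) (α := ι) (by simpa)
  refine ⟨toBBar p (M ∘ e), isHom_toBBar hp (fun k => hM (e k)) (fun k => hpM (e k)) ?_,
    fun a => toBBar_eq_top_iff⟩
  exact fun a ha => he.exists.1 (hcov a ha)

end HomToBBar

theorem exists_lt_card_ultraAbove {m : ℕ} {A : PAlg.{u}} (hA : A ∉ (Pa.{u} m).carrier) :
    ∃ p : PFilter A.carrier, p.IsPrime ∧ (m : ℕ∞) < ENat.card (ultraAbove p) := by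
  by_contra! hcard
  refine hA ((Pa m).mem_of_separating fun x y hxy => ?_)
  obtain ⟨p, hp, hxp, hyp⟩ := exists_isPrime_of_not_le hxy
  obtain ⟨f, hf, hfp⟩ := exists_isHom_BBar (hcard p hp) hp (M := Subtype.val)
    (fun M => M.2.1) (fun M => M.2.2) fun a ha =>
      let ⟨M, hM, haM⟩ := exists_mem_ultraAbove ha
      ⟨⟨M, hM⟩, haM⟩
  refine ⟨_, BBar_mem_Pa m, f, hf, fun hle => hyp ((hfp y).1 ?_)⟩
  exact top_le_iff.1 (((hfp x).2 hxp).ge.trans hle)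


section DisjointFamilies

variable {A : Type v} [PAlgebra A] {ι : Type w}

/-- The part of `xᵢ` disjoint from all other members of the family. -/
def disjointPart [Fintype ι] [DecidableEq ι] (x : ι → A) (i : ι) : A :=
  x i ⊓ pc ((Finset.univ.erase i).sup x)

theorem pairwise_disjoint_disjointPart [Fintype ι] [DecidableEq ι] (x : ι → A) :
    Pairwise (Disjoint on disjointPart x) := by
  intro i j hij
  have hj : disjointPart x j ≤ (Finset.univ.erase i).sup x :=
    inf_le_left.trans (Finset.le_sup (Finset.mem_erase.2 ⟨hij.symm, Finset.mem_univ j⟩))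
  exact (disjoint_pc_self _).mono inf_le_right hj

theorem disjointPart_eq_self [Fintype ι] [DecidableEq ι] {x : ι → A}
    (hx : Pairwise (Disjoint on x)) (i : ι) : disjointPart x i = x i := by
  refine inf_eq_left.2 (disjoint_iff_le_pc.1 (Finset.disjoint_sup_right.2 fun j hj => ?_))
  exact hx (Finset.ne_of_mem_erase hj).symm

theorem exists_pairwise_disjoint_mem [Finite ι] {M : ι → PFilter A}
    (hM : ∀ i, IsUltra (M i)) (hinj : Injective M) :
    ∃ d : ι → A, Pairwise (Disjoint on d) ∧ ∀ i, d i ∈ M i := by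
  classical
  cases nonempty_fintype ι
  have hsep : ∀ i j, ∃ c, i ≠ j → c ∈ M i ∧ c ∉ M j := by
    intro i j
    by_cases hij : M i ≤ M j
    · exact ⟨⊥, fun hne => (hne (hinj ((hM i).eq_of_le (hM j) hij))).elim⟩
    · obtain ⟨c, hc⟩ := SetLike.not_le_iff_exists.1 hij
      exact ⟨c, fun _ => hc⟩
  choose c hc using hsep
  let x : ι → A := fun i => (Finset.univ.erase i).inf (c i)
  have x_mem (i : ι) : x i ∈ M i :=
    Finset.inf_mem (M i : Set A) PFilter.top_mem (fun _ ha _ hb => PFilter.inf_mem ha hb) _ _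
      fun j hj => (hc i j (Finset.ne_of_mem_erase hj).symm).1
  have x_notMem {i j : ι} (hij : i ≠ j) : x i ∉ M j := fun h =>
    (hc i j hij).2
      (PFilter.mem_of_le (Finset.inf_le (Finset.mem_erase.2 ⟨hij.symm, Finset.mem_univ j⟩)) h)
  refine ⟨disjointPart x, pairwise_disjoint_disjointPart x, fun i => ?_⟩
  refine PFilter.inf_mem (x_mem i) ((hM i _).2 fun h => ?_)
  obtain ⟨j, hj, hxj⟩ := (finset_sup_mem_iff (hM i).isPrime).1 h
  exact x_notMem (Finset.ne_of_mem_erase hj) hxj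

end DisjointFamilies

section Lee

variable {ι : Type w} [Fintype ι] {m : ℕ}

/-- The left-hand side of Lee's identity `⋁ᵢ (xᵢ ∧ ⋀_{j ≠ i} xⱼ*)* = 1`. -/
def lee {A : Type v} [PAlgebra A] [DecidableEq ι] (x : ι → A) : A :=
  Finset.univ.sup fun i => pc (disjointPart x i)

theorem exists_eval_eq_finset_sup {κ : Type*} {X : Type w} (s : Finset κ) (t : κ → Term X) :
    ∃ r : Term X, ∀ (A : Type v) [PAlgebra A] (a : X → A),
      r.eval a = s.sup fun k => (t k).eval a := by
  classical
  induction s using Finset.induction_on with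
  | empty => exact ⟨.bot, fun A _ a => rfl⟩
  | insert k s _ ih =>
    obtain ⟨r, hr⟩ := ih
    refine ⟨.sup (t k) r, fun A _ a => ?_⟩
    rw [Finset.sup_insert, ← hr]
    rfl

theorem exists_eval_eq_lee (ι : Type w) [Fintype ι] [DecidableEq ι] :
    ∃ t : Term ι, ∀ (A : Type v) [PAlgebra A] (x : ι → A), t.eval x = lee x := by
  choose r hr using fun i : ι => exists_eval_eq_finset_sup.{v} (Finset.univ.erase i) Term.var
  obtain ⟨t, ht⟩ :=
    exists_eval_eq_finset_sup.{v} Finset.univ fun i : ι => .pc (.inf (.var i) (.pc (r i)))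
  refine ⟨t, fun A _ x => ?_⟩
  simp only [ht, Term.eval, hr]
  rfl

theorem card_le_of_pairwise_disjoint (hm : 1 ≤ m) {e : ι → BBar.{u} m}
    (he : Pairwise (Disjoint on e)) (hbot : ∀ i, e i ≠ ⊥) : Fintype.card ι ≤ m := by
  have exists_atom_le (x : BBar.{u} m) (hx : x ≠ ⊥) :
      ∃ k : ULift.{u} (Fin m), (({k} : Set (ULift.{u} (Fin m))) : BBar.{u} m) ≤ x := by
    induction x using WithTop.recTopCoe with
    | top => exact ⟨⟨⟨0, hm⟩⟩, le_top⟩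
    | coe s =>
      obtain ⟨k, hk⟩ := Set.nonempty_iff_ne_empty.2 fun h : s = ∅ => hx (congrArg _ h)
      exact ⟨k, WithTop.coe_le_coe.2 (Set.singleton_subset_iff.2 hk)⟩
  choose k hk using fun i => exists_atom_le (e i) (hbot i)
  have hinj : Injective k := by
    intro i j hij
    by_contra hne
    have h : {k i} ⊆ (∅ : Set (ULift.{u} (Fin m))) :=
      WithTop.coe_le_coe.1 (he hne (hk i) (hij ▸ hk j))
    exact h rfl
  simpa using Fintype.card_le_of_injective k hinj

variable [DecidableEq ι]

theorem lee_BBar (hm : 1 ≤ m) (hι : m < Fintype.card ι) (x : ι → BBar.{u} m) : lee x = ⊤ := by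
  by_contra hne
  refine hι.not_ge (card_le_of_pairwise_disjoint hm (pairwise_disjoint_disjointPart x) ?_)
  intro i hi
  have hle : pc (disjointPart x i) ≤ lee x :=
    Finset.le_sup (f := fun i => pc (disjointPart x i)) (Finset.mem_univ i)
  rw [hi, pc_bot] at hle
  exact hne (top_le_iff.1 hle)

theorem lee_eq_top_of_mem_Pa (hm : 1 ≤ m) (hι : m < Fintype.card ι) {A : PAlg.{u}}
    (hA : A ∈ (Pa.{u} m).carrier) (x : ι → A.carrier) : lee x = ⊤ := by
  obtain ⟨t, ht⟩ := exists_eval_eq_lee.{u} ι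
  rw [← ht]
  exact eval_eq_of_identities ((mem_HSP_iff _ _).1 hA) t .top
    (fun b => (ht _ b).trans (lee_BBar hm hι b)) x

theorem card_ultraAbove_le_of_mem_Pa (hm : 1 ≤ m) {A : PAlg.{u}} (hA : A ∈ (Pa.{u} m).carrier)
    {p : PFilter A.carrier} (hp : p.IsPrime) : ENat.card (ultraAbove p) ≤ m := by
  by_contra! hlt
  obtain ⟨e⟩ := nonempty_embedding_of_card_le (ι := Fin (m + 1)) (α := ultraAbove p)
    (by simpa using Order.add_one_le_of_lt hlt)
  obtain ⟨d, hd, hdM⟩ := exists_pairwise_disjoint_mem (fun i => (e i).2.1)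
    (Subtype.val_injective.comp e.injective)
  have htop : lee d ∈ p := lee_eq_top_of_mem_Pa hm (by simp) hA d ▸ PFilter.top_mem
  obtain ⟨i, -, hi⟩ := (finset_sup_mem_iff hp).1 htop
  rw [disjointPart_eq_self hd] at hi
  exact ((e i).2.1 (d i)).1 ((e i).2.2 hi) (hdM i)

end Lee


section DensePartition

variable {A : Type v} [PAlgebra A] {V : Type w} [Fintype V]

/-- A finite family of pairwise disjoint elements whose join is dense. -/
structure IsDensePartition (d : V → A) : Prop where
  pairwise_disjoint : Pairwise (Disjoint on d)
  pc_sup : pc (Finset.univ.sup d) = ⊥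

theorem exists_isDensePartition_ge [Nonempty V] {d : V → A} (hd : Pairwise (Disjoint on d)) :
    ∃ e : V → A, IsDensePartition e ∧ d ≤ e := by
  classical
  obtain ⟨o⟩ := ‹Nonempty V›
  let r : A := (Finset.univ.erase o).sup d
  let e : V → A := Function.update d o (pc r)
  have e_same : e o = pc r := Function.update_self ..
  have e_ne {i : V} (hi : i ≠ o) : e i = d i := Function.update_of_ne hi ..
  have le_r {i : V} (hi : i ≠ o) : d i ≤ r :=
    Finset.le_sup (Finset.mem_erase.2 ⟨hi, Finset.mem_univ i⟩)
  have d_le_e : d ≤ e := by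
    intro i
    by_cases hi : i = o
    · subst hi
      rw [e_same, ← disjoint_iff_le_pc]
      exact Finset.disjoint_sup_right.2 fun j hj => hd (Finset.ne_of_mem_erase hj).symm
    · exact (e_ne hi).ge
  have disjoint_e_o {i : V} (hi : i ≠ o) : Disjoint (e i) (e o) := by
    rw [e_same, e_ne hi]
    exact (disjoint_pc_self r).symm.mono_left (le_r hi)
  refine ⟨e, ⟨fun i j hij => ?_, le_bot_iff.1 ?_⟩, d_le_e⟩
  · rcases eq_or_ne j o with rfl | hj
    · exact disjoint_e_o hij
    rcases eq_or_ne i o with rfl | hi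
    · exact (disjoint_e_o hj).symm
    simpa only [onFun, e_ne hi, e_ne hj] using hd hij
  · rw [← pc_sup_pc_self r]
    refine pc_anti (sup_le (Finset.sup_le fun i _ => ?_) ?_)
    · exact (d_le_e i).trans (Finset.le_sup (Finset.mem_univ i))
    · exact e_same.ge.trans (Finset.le_sup (Finset.mem_univ o))

theorem exists_isDensePartition_mem [Nonempty V] {M : V → PFilter A} (hM : ∀ i, IsUltra (M i))
    (hinj : Injective M) : ∃ d : V → A, IsDensePartition d ∧ ∀ i, d i ∈ M i := by
  obtain ⟨d, hd, hdM⟩ := exists_pairwise_disjoint_mem hM hinj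
  obtain ⟨e, he, hde⟩ := exists_isDensePartition_ge hd
  exact ⟨e, he, fun i => PFilter.mem_of_le (hde i) (hdM i)⟩

end DensePartition

section LowerSet

/-- A Heyting algebra, with its own pseudocomplement, as a p-algebra. -/
abbrev PAlgebra.ofHeyting (H : Type v) [HeytingAlgebra H] : PAlgebra H where
  pc := (·ᶜ)
  inf_eq_bot_iff _ _ := disjoint_iff.symm.trans le_compl_iff_disjoint_right.symm

variable {P : Type v} [Preorder P] {x : P} {D : LowerSet P}

instance instPAlgebraLowerSet : PAlgebra (LowerSet P) := .ofHeyting _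

theorem mem_pc_lowerSet : x ∈ pc D ↔ ∀ y ≤ x, y ∉ D := by
  rw [← LowerSet.Iic_le, ← disjoint_iff_le_pc, disjoint_iff_inf_le]
  exact ⟨fun h y hy hyD => h ⟨hy, hyD⟩, fun h y hy => h y hy.1 hy.2⟩

/-- The prime filter of the down-sets containing a given point. -/
def pointFilter (x : P) : PFilter (LowerSet P) :=
  PFilter.principal (LowerSet.Iic x)

theorem mem_pointFilter : D ∈ pointFilter x ↔ x ∈ D :=
  PFilter.mem_principal.trans LowerSet.Iic_le

theorem isPrime_pointFilter (x : P) : (pointFilter x).IsPrime := by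
  refine isPrime_iff_sup.2 ⟨?_, fun D E => ?_⟩
  · rw [mem_pointFilter]
    exact LowerSet.notMem_bot
  · simp only [mem_pointFilter, LowerSet.mem_sup_iff, imp_self]

theorem isUltra_pointFilter (hx : IsMin x) : IsUltra (pointFilter x) := by
  intro D
  rw [mem_pointFilter, mem_pointFilter, mem_pc_lowerSet]
  exact ⟨fun h => h x le_rfl, fun h y hy hyD => h (D.lower (hx hy) hyD)⟩

theorem pointFilter_le_pointFilter {x y : P} : pointFilter x ≤ pointFilter y ↔ y ≤ x := by
  rw [pointFilter, PFilter.principal_le_iff, mem_pointFilter, LowerSet.mem_Iic_iff]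

end LowerSet

section Complexes

/-- The nonempty finite sets of vertices from `V`, ordered by inclusion. -/
abbrev Simplex (V : Type u) : Type u := {s : Finset V // s.Nonempty}

/-- Simplicial complexes with vertices in `V`. -/
abbrev Cplx (V : Type u) : Type u := LowerSet (Simplex V)

variable {V : Type u}

/-- The simplex with the single vertex `i`. -/
def vertex (i : V) : Simplex V := ⟨{i}, Finset.singleton_nonempty i⟩

instance instOrderTopSimplex [Fintype V] [Nonempty V] : OrderTop (Simplex V) where
  top := ⟨Finset.univ, Finset.univ_nonempty⟩
  le_top s := Finset.subset_univ s.1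

theorem vertex_le_iff {i : V} {s : Simplex V} : vertex i ≤ s ↔ i ∈ s.1 :=
  Finset.singleton_subset_iff

theorem isMin_vertex (i : V) : IsMin (vertex i) := fun s hs =>
  vertex_le_iff.2 (((Finset.Nonempty.subset_singleton_iff s.2).1 hs) ▸ Finset.mem_singleton_self i)

theorem vertex_injective : Injective (vertex : V → Simplex V) := fun _ _ h =>
  Finset.singleton_injective (congrArg Subtype.val h)

theorem exists_isHom_BBar_of_card_le {m : ℕ} {s : Simplex V} (hs : s.1.card ≤ m) :
    ∃ f : Cplx V → BBar.{u} m, IsHom f ∧ ∀ D, f D = ⊤ ↔ s ∈ D := by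
  simp only [← mem_pointFilter]
  refine exists_isHom_BBar (ι := s.1) (by simpa) (isPrime_pointFilter s)
    (fun i => isUltra_pointFilter (isMin_vertex i.1))
    (fun i => pointFilter_le_pointFilter.2 (vertex_le_iff.2 i.2)) fun D hD => ?_
  rw [mem_pointFilter, mem_pc_lowerSet] at hD
  push Not at hD
  obtain ⟨t, hts, htD⟩ := hD
  obtain ⟨i, hi⟩ := t.2
  exact ⟨⟨i, hts hi⟩, mem_pointFilter.2 (D.lower (vertex_le_iff.2 hi) htD)⟩

theorem Cplx_notMem_Pa {m : ℕ} [Fintype V] (hm : 1 ≤ m) (hV : m < Fintype.card V) :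
    (⟨Cplx V⟩ : PAlg.{u}) ∉ (Pa.{u} m).carrier := by
  intro h
  have : Nonempty V := Fintype.card_pos_iff.1 (Nat.zero_lt_of_lt hV)
  let M (i : V) : ultraAbove (pointFilter (⊤ : Simplex V)) :=
    ⟨pointFilter (vertex i), isUltra_pointFilter (isMin_vertex i),
      pointFilter_le_pointFilter.2 le_top⟩
  have hM : Injective M := fun i j hij => by
    have h := congrArg Subtype.val hij
    exact vertex_injective
      ((pointFilter_le_pointFilter.1 h.ge).antisymm (pointFilter_le_pointFilter.1 h.le))
  have hcard : ENat.card V ≤ m := (ENat.card_le_card_of_injective hM).trans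
    (card_ultraAbove_le_of_mem_Pa hm h (isPrime_pointFilter ⊤))
  rw [ENat.card_eq_coe_fintype_card, Nat.cast_le] at hcard
  exact hV.not_ge hcard

end Complexes

section CplxMap

open Classical in
/-- The join in the skeleton of the members of a dense partition indexed by `s`, encoded as the
pseudocomplement of the join of the other members. -/
noncomputable def skelSup {A : Type v} [PAlgebra A] {V : Type u} [Fintype V] (d : V → A)
    (s : Finset V) : A :=
  pc (sᶜ.sup d)

open Classical in
/-- The map from the simplicial complexes on `V` to `A` induced by a dense partition of `A`. -/
noncomputable def cplxMap {A : Type v} [PAlgebra A] {V : Type u} [Fintype V] (d : V → A)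
    (D : Cplx V) : A :=
  (Finset.univ.filter (· ∈ D)).sup fun s => skelSup d s.1

variable {A : Type v} [PAlgebra A] {V : Type u} [Fintype V] {d : V → A} {a : A}

open Classical in
theorem skelSup_inter (s t : Finset V) : skelSup d (s ∩ t) = skelSup d s ⊓ skelSup d t := by
  rw [skelSup, Finset.compl_inter, Finset.sup_union, pc_sup]
  rfl

theorem skelSup_univ : skelSup d Finset.univ = ⊤ := by
  classical
  rw [skelSup, Finset.compl_univ, Finset.sup_empty, pc_bot]

theorem skelSup_le_pc {s : Finset V} {i : V} (hi : i ∉ s) : skelSup d s ≤ pc (d i) := by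
  classical
  exact pc_anti (Finset.le_sup (Finset.mem_compl.2 hi))

theorem IsDensePartition.skelSup_empty (hd : IsDensePartition d) : skelSup d ∅ = ⊥ := by
  classical
  rw [skelSup, Finset.compl_empty, hd.pc_sup]

theorem IsDensePartition.le_skelSup (hd : IsDensePartition d) {s : Finset V} {i : V}
    (hi : i ∈ s) : d i ≤ skelSup d s := by
  classical
  refine disjoint_iff_le_pc.1 (Finset.disjoint_sup_right.2 fun j hj => hd.pairwise_disjoint ?_)
  rintro rfl
  exact Finset.mem_compl.1 hj hi

theorem cplxMap_le_iff {D : Cplx V} : cplxMap d D ≤ a ↔ ∀ s ∈ D, skelSup d s.1 ≤ a := by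
  simp [cplxMap]

theorem skelSup_le_cplxMap {D : Cplx V} {s : Simplex V} (hs : s ∈ D) :
    skelSup d s.1 ≤ cplxMap d D :=
  cplxMap_le_iff.1 le_rfl s hs

theorem cplxMap_mono : Monotone (cplxMap d) := fun _ _ h =>
  cplxMap_le_iff.2 fun _ hs => skelSup_le_cplxMap (h hs)

theorem cplxMap_sup (D E : Cplx V) : cplxMap d (D ⊔ E) = cplxMap d D ⊔ cplxMap d E := by
  refine le_antisymm (cplxMap_le_iff.2 fun s hs => ?_)
    (sup_le (cplxMap_mono le_sup_left) (cplxMap_mono le_sup_right))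
  exact hs.elim (fun h => (skelSup_le_cplxMap h).trans le_sup_left)
    fun h => (skelSup_le_cplxMap h).trans le_sup_right

theorem cplxMap_bot : cplxMap d (⊥ : Cplx V) = ⊥ :=
  le_bot_iff.1 (cplxMap_le_iff.2 fun _ hs => hs.elim)

theorem cplxMap_top [Nonempty V] : cplxMap d (⊤ : Cplx V) = ⊤ := by
  have hle := skelSup_le_cplxMap (d := d) (LowerSet.mem_top (a := (⊤ : Simplex V)))
  exact top_le_iff.1 (skelSup_univ.ge.trans hle)

open Classical in
theorem IsDensePartition.skelSup_inter_le_cplxMap (hd : IsDensePartition d) {D E : Cplx V}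
    {s t : Simplex V} (hs : s ∈ D) (ht : t ∈ E) :
    skelSup d (s.1 ∩ t.1) ≤ cplxMap d (D ⊓ E) := by
  rcases (s.1 ∩ t.1).eq_empty_or_nonempty with h | h
  · rw [h, hd.skelSup_empty]
    exact bot_le
  · exact skelSup_le_cplxMap (s := ⟨_, h⟩)
      ⟨D.lower (show _ ≤ s.1 from Finset.inter_subset_left) hs,
        E.lower (show _ ≤ t.1 from Finset.inter_subset_right) ht⟩

theorem IsDensePartition.cplxMap_inf (hd : IsDensePartition d) (D E : Cplx V) :
    cplxMap d (D ⊓ E) = cplxMap d D ⊓ cplxMap d E := by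
  classical
  refine le_antisymm (le_inf (cplxMap_mono inf_le_left) (cplxMap_mono inf_le_right)) ?_
  rw [cplxMap, cplxMap, Finset.sup_inf_sup]
  refine Finset.sup_le fun ⟨s, t⟩ hst => ?_
  obtain ⟨hs, ht⟩ := Finset.mem_product.1 hst
  rw [← skelSup_inter]
  exact hd.skelSup_inter_le_cplxMap (Finset.mem_filter.1 hs).2 (Finset.mem_filter.1 ht).2

theorem IsDensePartition.cplxMap_pc (hd : IsDensePartition d) (D : Cplx V) :
    cplxMap d (pc D) = pc (cplxMap d D) := by
  classical
  refine le_antisymm ?_ ?_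
  · rw [← disjoint_iff_le_pc, disjoint_iff, ← hd.cplxMap_inf, (disjoint_pc_self D).eq_bot,
      cplxMap_bot]
  let T : Finset V := Finset.univ.filter fun i => vertex i ∉ D
  have le_skelSup_T : pc (cplxMap d D) ≤ skelSup d T := by
    refine pc_anti (Finset.sup_le fun i hi => ?_)
    have hiD : vertex i ∈ D := by simpa [T] using hi
    exact (hd.le_skelSup (Finset.mem_singleton_self i)).trans (skelSup_le_cplxMap hiD)
  refine le_skelSup_T.trans ?_
  rcases T.eq_empty_or_nonempty with hT | hT
  · rw [hT, hd.skelSup_empty]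
    exact bot_le
  · refine skelSup_le_cplxMap (s := ⟨T, hT⟩) (mem_pc_lowerSet.2 fun t htT htD => ?_)
    obtain ⟨i, hi⟩ := t.2
    exact (Finset.mem_filter.1 (htT hi)).2 (D.lower (vertex_le_iff.2 hi) htD)

theorem IsDensePartition.isHom_cplxMap [Nonempty V] (hd : IsDensePartition d) :
    IsHom (cplxMap d) where
  map_bot := cplxMap_bot
  map_top := cplxMap_top
  map_inf := hd.cplxMap_inf
  map_sup := cplxMap_sup
  map_pc := hd.cplxMap_pc

theorem cplxMap_mem_iff [Nonempty V] {p : PFilter A} (hp : p.IsPrime) {M : V → PFilter A}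
    (hM : ∀ i, IsUltra (M i)) (hpM : ∀ i, p ≤ M i) (hdM : ∀ i, d i ∈ M i) {D : Cplx V} :
    cplxMap d D ∈ p ↔ ⊤ ∈ D := by
  classical
  have eq_top_of_mem (s : Simplex V) (hs : skelSup d s.1 ∈ p) : s = ⊤ := by
    refine Subtype.ext (Finset.eq_univ_of_forall fun i => by_contra fun hi => ?_)
    exact (hM i (d i)).1 (hpM i (PFilter.mem_of_le (skelSup_le_pc hi) hs)) (hdM i)
  refine ⟨fun h => ?_, fun h => ?_⟩
  · obtain ⟨s, hs, hsp⟩ := (finset_sup_mem_iff hp).1 h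
    exact eq_top_of_mem s hsp ▸ (Finset.mem_filter.1 hs).2
  · exact PFilter.mem_of_le (skelSup_univ.ge.trans (skelSup_le_cplxMap h)) PFilter.top_mem

end CplxMap

section Cover

variable {m : ℕ}

theorem Cplx_mem_of_lt {V : Type u} [Fintype V] [Nonempty V] (hV : Fintype.card V ≤ m + 1)
    {L : Subquasivariety.{u}} (hL : Pa.{u} m < L) : (⟨Cplx V⟩ : PAlg.{u}) ∈ L.carrier := by
  obtain ⟨A, hAL, hA⟩ := Set.not_subset.1 (lt_iff_le_not_ge.1 hL).2
  obtain ⟨p, hp, hcard⟩ := exists_lt_card_ultraAbove hA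
  have hVp : (Fintype.card V : ℕ∞) ≤ ENat.card (ultraAbove p) :=
    (Nat.cast_le.2 hV).trans (by simpa using Order.add_one_le_of_lt hcard)
  obtain ⟨M⟩ := nonempty_embedding_of_card_le hVp
  obtain ⟨d, hd, hdM⟩ := exists_isDensePartition_mem (fun i => (M i).2.1)
    (Subtype.val_injective.comp M.injective)
  refine L.mem_of_separating fun (D E : Cplx V) hDE => ?_
  obtain ⟨s, hsD, hsE⟩ := Set.not_subset.1 hDE
  by_cases hs : s.1.card ≤ m
  · obtain ⟨f, hf, hfs⟩ := exists_isHom_BBar_of_card_le hs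
    refine ⟨_, hL.le (BBar_mem_Pa m), f, hf, fun hle => hsE ((hfs E).1 ?_)⟩
    exact top_le_iff.1 (((hfs D).2 hsD).ge.trans hle)
  · obtain rfl : s = ⊤ := Subtype.ext ((Finset.card_eq_iff_eq_univ s.1).1
      (s.1.card_le_univ.antisymm (hV.trans (not_le.1 hs))))
    have mem_iff (D : Cplx V) : cplxMap d D ∈ p ↔ ⊤ ∈ D :=
      cplxMap_mem_iff hp (fun i => (M i).2.1) (fun i => (M i).2.2) hdM
    refine ⟨A, hAL, cplxMap d, hd.isHom_cplxMap, fun hle => hsE ?_⟩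
    exact (mem_iff E).1 (PFilter.mem_of_le hle ((mem_iff D).2 hsD))

theorem isLeast_Ioi_Pa (hm : 1 ≤ m) :
    IsLeast (Set.Ioi (Pa.{u} m)) (Subquasivariety.generate
      (insert ⟨Cplx (ULift.{u} (Fin (m + 1)))⟩ (Pa.{u} m).carrier)) := by
  obtain ⟨hC, hPa⟩ := Set.insert_subset_iff.1 (Subquasivariety.generate_le_iff.1 le_rfl)
  refine ⟨lt_of_le_not_ge hPa fun h => Cplx_notMem_Pa hm (by simp) (h hC), fun L hL => ?_⟩
  exact Subquasivariety.generate_le_iff.2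
    (Set.insert_subset (Cplx_mem_of_lt (by simp) hL) hL.le)

end Cover

end PAlgebras

theorem theorem3p6_general (m : ℕ) (hm : 1 ≤ m) :
    ∃! K : PAlgebras.Subquasivariety.{u}, PAlgebras.Pa.{u} m ⋖ K :=
  PAlgebras.existsUnique_covBy_of_isLeast_Ioi (PAlgebras.isLeast_Ioi_Pa hm)

theorem theorem3p6 (m : ℕ) (hm : 2 ≤ m) :
    ∃! K : PAlgebras.Subquasivariety.{u}, PAlgebras.Pa.{u} m ⋖ K := by
  exact theorem3p6_general m (one_le_two.trans hm)
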